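/- **Setting.** There are $n$ banks; bank $i$ holds $a_i>0$ shares of an illiquid asset and has a cash shortfall $h_i>0$. The repo rate is $r\ge 0$, and $M\ge\sum_i a_i$ is the total market capitalization. Put $D=\prod_i[0,a_i]$. Let $f:[0,M]\to(0,1]$ be an order book density and $g:[0,M]\to(0,1]$ a haircut function. Under volume weighted average pricing (VWAP), every bank obtains the price $\bar f_i(s)=\frac{1}{S}\int_0^{S}f(\sigma)\,d\sigma$, $S=\sum_j s_j$, for $s\in D\setminus\{0\}$, and $\bar f_i(0)=1$. **Equilibrium.** For a fixed haircut $q$ and fixed prices $\bar q=(\bar q_1,\dots,\bar q_n)$, a profile $s\in D$ is a Nash equilibrium if for every bank $i$: $s_i=a_i$ whenever $h_i\ge a_i\bar q_i$ (default); and, whenever $h_i<a_i\bar q_i$, the number $s_i$ minimizes $x\mapsto x\,(1-\bar f_i(x,s_{-i}))+r\,(h_i-x\,\bar f_i(x,s_{-i}))$ over all $x\in[0,a_i]$ with $\frac{h_i-a_iq}{\bar q_i-q}\le x\le\frac{h_i}{\bar q_i}$. The pair $(q,\bar q)$ is a *clearing haircut and price vector* if some such Nash equilibrium $s$ satisfies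 $q=g(\sum_j s_j)$ and $\bar q_i=\bar f_i(s)$ for all $i$. **Assumptions.** - $f$ is strictly decreasing and twice continuously differentiable on $[0,M]$ with $f(0)=1$, and $f'\le 0$ is nondecreasing. - $g$ is continuous, convex and strictly decreasing on $[0,M]$, and $g(\sum_j s_j)<\bar f_i(s)$ for all $s\in D$ and all $i$. - For every $i$ and every $s_{-i}\in\prod_{j\ne i}[0,a_j]$, the map $s_i\mapsto s_i\bar f_i(s_i,s_{-i})+(a_i-s_i)\,g(\sum_j s_j)$ is strictly increasing on $[0,a_i]$. **Theorem.** The set of clearing haircut and price vectors $(q,\bar q)\in\mathbb{R}\times\mathbb{R}^n$, with the componentwise order, is a (complete) lattice: every subset of it has a supremum and an infimum within the set. In particular, there are a greatest and a least clearing vector, $(q^\uparrow,\bar q^\uparrow)\ge(q^\downarrow,\bar q^\downarrow)$. -/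

import Mathlib

open Set

namespace RepoFireSale

variable {n : ℕ}

/-- The set `∏ⱼ [0, aⱼ]` of admissible liquidations when bank `j` holds `a j` shares. -/
def Sales (a : Fin n → ℝ) : Set (Fin n → ℝ) :=
  {s | ∀ i, s i ∈ Icc 0 (a i)}

open Classical in
/-- Volume weighted average price for the order book density `f`: every bank gets the price
`(1 / S) ∫₀^S f`, where `S = ∑ⱼ sⱼ` is the total liquidation, and `1` if nothing is sold. -/
noncomputable def vwap (f : ℝ → ℝ) : Fin n → (Fin n → ℝ) → ℝ :=
  fun _ s => if s = 0 then 1 else (∫ σ in (0 : ℝ)..(∑ j, s j), f σ) / ∑ j, s j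

/-- Cost of bank `i` at the liquidations `s`: the loss from the sale plus the interest, at the
repo rate `r`, on the borrowed amount `h i - s i * fbar i s`. -/
def cost (h : Fin n → ℝ) (r : ℝ) (fbar : Fin n → (Fin n → ℝ) → ℝ) (i : Fin n)
    (s : Fin n → ℝ) : ℝ :=
  s i * (1 - fbar i s) + r * (h i - s i * fbar i s)

/-- Liquidations feasible for bank `i` at the fixed haircut `q` and fixed prices `qbar`: it does
not raise more than its shortfall, and it keeps enough collateral to cover its loan. -/
def feasible (a h : Fin n → ℝ) (q : ℝ) (qbar : Fin n → ℝ) (i : Fin n) : Set ℝ :=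
  {x | x ∈ Icc 0 (a i) ∧ x ≤ h i / qbar i ∧ (h i - a i * q) / (qbar i - q) ≤ x}

/-- In the profile `s`, bank `i` plays a best response to the other banks, given `(q, qbar)`.
A defaulting bank (`a i * qbar i ≤ h i`) liquidates everything; a solvent one minimizes its cost
over its feasible liquidations. In the cost the price impact of the bank's own deviation is taken
into account, while the constraints use the fixed `(q, qbar)`. -/
def IsBestResponse (a h : Fin n → ℝ) (r : ℝ) (fbar : Fin n → (Fin n → ℝ) → ℝ) (q : ℝ)
    (qbar : Fin n → ℝ) (s : Fin n → ℝ) (i : Fin n) : Prop :=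
  (a i * qbar i ≤ h i → s i = a i) ∧
  (h i < a i * qbar i → s i ∈ feasible a h q qbar i ∧
    IsMinOn (fun x => cost h r fbar i (Function.update s i x)) (feasible a h q qbar i) (s i))

/-- `s` is a Nash equilibrium of the liquidation game with fixed haircut and prices. -/
def IsNash (a h : Fin n → ℝ) (r : ℝ) (fbar : Fin n → (Fin n → ℝ) → ℝ) (q : ℝ)
    (qbar : Fin n → ℝ) (s : Fin n → ℝ) : Prop :=
  s ∈ Sales a ∧ ∀ i, IsBestResponse a h r fbar q qbar s i

/-- The set of clearing haircuts and prices `(q, qbar)`: those for which some Nash equilibrium of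
the game with `(q, qbar)` fixed reproduces `(q, qbar)`. It is ordered componentwise. -/
def clearing (a h : Fin n → ℝ) (r : ℝ) (fbar : Fin n → (Fin n → ℝ) → ℝ) (g : ℝ → ℝ) :
    Set (ℝ × (Fin n → ℝ)) :=
  {p | ∃ s, IsNash a h r fbar p.1 p.2 s ∧ p.1 = g (∑ j, s j) ∧ ∀ i, p.2 i = fbar i s}

/-- Assumptions on the haircut function `g : [0, M] → (0, 1]`. -/
structure HaircutAssumption (a : Fin n → ℝ) (M : ℝ) (fbar : Fin n → (Fin n → ℝ) → ℝ)
    (g : ℝ → ℝ) : Prop where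
  mapsTo : MapsTo g (Icc 0 M) (Ioc 0 1)
  continuousOn : ContinuousOn g (Icc 0 M)
  convexOn : ConvexOn ℝ (Icc 0 M) g
  strictAntiOn : StrictAntiOn g (Icc 0 M)
  lt_price : ∀ s ∈ Sales a, ∀ i, g (∑ j, s j) < fbar i s

/-- The cash a bank can raise by selling and borrowing strictly increases with its own sales. -/
def FundingAssumption (a : Fin n → ℝ) (fbar : Fin n → (Fin n → ℝ) → ℝ) (g : ℝ → ℝ) : Prop :=
  ∀ s ∈ Sales a, ∀ i, StrictMonoOn
    (fun x => x * fbar i (Function.update s i x) +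
      (a i - x) * g (∑ j, Function.update s i x j)) (Icc 0 (a i))

/-- Assumptions on the order book density `f : [0, M] → (0, 1]`; derivatives at the end points
are one-sided. -/
structure OrderBookAssumption (M : ℝ) (f : ℝ → ℝ) : Prop where
  mapsTo : MapsTo f (Icc 0 M) (Ioc 0 1)
  strictAntiOn : StrictAntiOn f (Icc 0 M)
  contDiffOn : ContDiffOn ℝ 2 f (Icc 0 M)
  map_zero : f 0 = 1
  deriv_nonpos : ∀ x ∈ Icc 0 M, derivWithin f (Icc 0 M) x ≤ 0
  deriv_monotoneOn : MonotoneOn (derivWithin f (Icc 0 M)) (Icc 0 M)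

end RepoFireSale

namespace RepoFireSale

variable {n : ℕ}

/-! Prices depend only on the total sale `S`, so the problem becomes scalar. At a fixed total, a
bank's first order condition is linear in its own sale. Hence its best response is an explicit
continuous function `B i S`, the target sale truncated to the feasible interval (`isMinOn_cost_iff`,
`isBestResponse_iff`). Equilibria thus correspond to zeros of `∑ i, B i S - S` on `[0, ∑ a i]`.
These form a compact set, nonempty by the intermediate value theorem
(`exists_compact_parametrization`). Haircut and price fall as `S` grows, the haircut strictly, so
the clearing set is a chain, order-reversed from a compact set of reals, where suprema and infima
exist. `B i` need not be monotone, and no Tarski argument is used. -/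

/-! ### Regularity of the average price. -/

/-- The derivative of the order book density extends from `[0, M]` to a continuous, monotone and
nonpositive function on the whole line, which is negative on `[0, M)`. -/
theorem exists_deriv_extension {M : ℝ} {f : ℝ → ℝ} (hM : 0 < M) (hf : OrderBookAssumption M f) :
    ∃ k : ℝ → ℝ, Continuous k ∧ Monotone k ∧ (∀ x, k x ≤ 0) ∧ (∀ x ∈ Ico 0 M, k x < 0) ∧
      ∀ x ∈ Icc 0 M, f x = 1 + ∫ u in (0 : ℝ)..x, k u := by
  set p : ℝ → ℝ := fun x => max 0 (min M x) with hp
  have hpmem : ∀ x, p x ∈ Icc 0 M := fun x => ⟨le_max_left _ _, max_le hM.le (min_le_left _ _)⟩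
  have hpid : ∀ x ∈ Icc 0 M, p x = x := fun x hx => by
    simp only [hp]; rw [min_eq_right hx.2, max_eq_right hx.1]
  have hpmono : Monotone p := fun x y hxy => max_le_max le_rfl (min_le_min le_rfl hxy)
  have hpcont : Continuous p := by fun_prop
  set k : ℝ → ℝ := fun x => derivWithin f (Icc 0 M) (p x) with hk
  have hkcont : Continuous k :=
    (hf.contDiffOn.continuousOn_derivWithin (uniqueDiffOn_Icc hM) (by norm_num)).comp_continuous
      hpcont hpmem
  have hkmono : Monotone k := fun x y hxy =>
    hf.deriv_monotoneOn (hpmem x) (hpmem y) (hpmono hxy)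
  have hkint : ∀ x ∈ Icc 0 M, ∀ y ∈ Icc 0 M, x ≤ y → ∫ u in x..y, k u = f y - f x := by
    intro x hx y hy hxy
    refine intervalIntegral.integral_eq_sub_of_hasDeriv_right ?_ ?_
      (hkcont.intervalIntegrable _ _)
    · rw [uIcc_of_le hxy]
      exact hf.contDiffOn.continuousOn.mono (Icc_subset_Icc hx.1 hy.2)
    · rw [min_eq_left hxy, max_eq_right hxy]
      intro u hu
      have huI : u ∈ Ioo 0 M := ⟨hx.1.trans_lt hu.1, hu.2.trans_le hy.2⟩
      have hd := (hf.contDiffOn.differentiableOn (by norm_num) u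
        (Ioo_subset_Icc_self huI)).hasDerivWithinAt.hasDerivAt (Icc_mem_nhds huI.1 huI.2)
      have : k u = derivWithin f (Icc 0 M) u := by
        simp only [hk, hpid u (Ioo_subset_Icc_self huI)]
      rw [this]
      exact hd.hasDerivWithinAt
  have hkle : ∀ x, k x ≤ 0 := fun x => hf.deriv_nonpos _ (hpmem x)
  refine ⟨k, hkcont, hkmono, hkle, ?_, ?_⟩
  · intro x hx
    -- A zero of the monotone nonpositive `k` before `M` would persist up to `M`, making `f`
    -- constant there.
    by_contra hneg
    have h0 : ∀ u ∈ uIcc x M, k u = 0 := by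
      intro u hu
      rw [uIcc_of_le hx.2.le] at hu
      exact le_antisymm (hkle u) ((not_lt.1 hneg).trans (hkmono hu.1))
    have h1 := hkint x ⟨hx.1, hx.2.le⟩ M ⟨hM.le, le_rfl⟩ hx.2.le
    rw [intervalIntegral.integral_congr (g := fun _ => (0 : ℝ)) h0] at h1
    have h2 := hf.strictAntiOn ⟨hx.1, hx.2.le⟩ ⟨hM.le, le_rfl⟩ hx.2
    simp at h1
    linarith
  · intro x hx
    rw [hkint 0 ⟨le_rfl, hM.le⟩ x hx hx.1, hf.map_zero]
    ring

/-- The volume weighted average price, as a function of the total liquidation, extends to a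
differentiable convex function on the line whose marginal revenue is nonincreasing. -/
theorem exists_average_extension {M : ℝ} {f : ℝ → ℝ} (hM : 0 < M)
    (hf : OrderBookAssumption M f) :
    ∃ F D : ℝ → ℝ, (∀ S, HasDerivAt F (D S) S) ∧ Continuous D ∧ Monotone D ∧
      (∀ S, D S ≤ 0) ∧
      (∀ S ∈ Icc 0 M, D S < 0) ∧ Antitone (fun S => F S + S * D S) ∧ F 0 = 1 ∧
      ∀ S ∈ Icc 0 M, S * F S = ∫ σ in (0 : ℝ)..S, f σ := by
  obtain ⟨k, hkc, hkm, hk0, hkneg, hkf⟩ := exists_deriv_extension hM hf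
  set φ : ℝ → ℝ := fun x => 1 + ∫ u in (0 : ℝ)..x, k u with hφ
  have hφd : ∀ x, HasDerivAt φ (k x) x := fun x =>
    (hkc.integral_hasStrictDerivAt 0 x).hasDerivAt.const_add 1
  have hφdiff : Differentiable ℝ φ := fun x => (hφd x).differentiableAt
  have hφc : Continuous φ := hφdiff.continuous
  have hφanti : Antitone φ := antitone_of_deriv_nonpos hφdiff fun x => by
    rw [(hφd x).deriv]; exact hk0 x
  -- Rescaling the average to `[0, 1]` removes the singularity at `S = 0`.
  set F : ℝ → ℝ := fun S => ∫ t in (0 : ℝ)..1, φ (t * S) with hF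
  set D : ℝ → ℝ := fun S => ∫ t in (0 : ℝ)..1, k (t * S) * t with hD
  have hFD : ∀ S, HasDerivAt F (D S) S := by
    intro S
    refine (intervalIntegral.hasDerivAt_integral_of_dominated_loc_of_deriv_le
      (F := fun S t => φ (t * S)) (F' := fun S t => k (t * S) * t)
      (bound := fun _ => -k (-(|S| + 1))) (s := Metric.ball S 1)
      (Metric.ball_mem_nhds S one_pos) ?_ ?_ ?_ ?_ ?_ ?_).2
    · exact Filter.Eventually.of_forall fun x =>
        (by fun_prop : Continuous fun t => φ (t * x)).aestronglyMeasurable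
    · exact (by fun_prop : Continuous fun t => φ (t * S)).intervalIntegrable _ _
    · exact (by fun_prop : Continuous fun t => k (t * S) * t).aestronglyMeasurable
    · refine Filter.Eventually.of_forall fun t ht x hx => ?_
      rw [uIoc_of_le zero_le_one] at ht
      have hx' : |x| ≤ |S| + 1 := by
        have h1 : |x - S| < 1 := by simpa [Real.dist_eq] using hx
        have h2 := abs_add_le (x - S) S
        rw [sub_add_cancel] at h2
        linarith
      have hb : -(|S| + 1) ≤ t * x := by
        have h3 : |t * x| ≤ |S| + 1 := by
          rw [abs_mul, abs_of_pos ht.1]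
          exact (mul_le_of_le_one_left (abs_nonneg x) ht.2).trans hx'
        exact (abs_le.1 h3).1
      rw [Real.norm_eq_abs, abs_mul, abs_of_pos ht.1, abs_of_nonpos (hk0 _)]
      exact (mul_le_of_le_one_right (neg_nonneg.2 (hk0 _)) ht.2).trans (neg_le_neg (hkm hb))
    · exact intervalIntegrable_const
    · refine Filter.Eventually.of_forall fun t _ x _ => ?_
      have h1 : HasDerivAt (fun x : ℝ => t * x) t x := by
        simpa using (hasDerivAt_id x).const_mul t
      exact (hφd (t * x)).comp x h1
  have hSF : ∀ S, S * F S = ∫ σ in (0 : ℝ)..S, φ σ := by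
    intro S
    simp [hF]
  have hmarg : ∀ S, F S + S * D S = φ S := by
    intro S
    have h1 : HasDerivAt (fun S => S * F S) (1 * F S + S * D S) S :=
      (hasDerivAt_id S).mul (hFD S)
    have h2 : HasDerivAt (fun S => S * F S) (φ S) S := by
      rw [funext hSF]
      exact (hφc.integral_hasStrictDerivAt 0 S).hasDerivAt
    rw [← h1.unique h2, one_mul]
  have hDmono : Monotone D := by
    intro S T hST
    refine intervalIntegral.integral_mono_on zero_le_one
      ((by fun_prop : Continuous fun t => k (t * S) * t).intervalIntegrable _ _)
      ((by fun_prop : Continuous fun t => k (t * T) * t).intervalIntegrable _ _) fun t ht => ?_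
    exact mul_le_mul_of_nonneg_right (hkm (mul_le_mul_of_nonneg_left hST ht.1)) ht.1
  have hDneg : ∀ S ∈ Icc 0 M, D S < 0 := by
    intro S hS
    have h1 : 0 < ∫ t in (0 : ℝ)..1, -(k (t * S) * t) := by
      refine intervalIntegral.intervalIntegral_pos_of_pos_on
        ((by fun_prop : Continuous fun t => -(k (t * S) * t)).intervalIntegrable _ _)
        (fun t ht => ?_) one_pos
      -- `k` may vanish at `M`, but `t < 1` keeps the argument below it, even for `S = M`.
      have h2 : t * S < M := by
        rcases hS.1.eq_or_lt with h0 | h0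
        · rwa [← h0, mul_zero]
        · exact (mul_lt_of_lt_one_left h0 ht.2).trans_le hS.2
      have h3 := hkneg (t * S) ⟨mul_nonneg ht.1.le hS.1, h2⟩
      exact neg_pos.2 (mul_neg_of_neg_of_pos h3 ht.1)
    rw [intervalIntegral.integral_neg] at h1
    exact neg_pos.1 h1
  refine ⟨F, D, hFD, ?_, hDmono, ?_, hDneg, ?_, ?_, ?_⟩
  · exact intervalIntegral.continuous_parametric_intervalIntegral_of_continuous'
      (f := fun S t => k (t * S) * t) (by fun_prop) 0 1
  · intro S
    refine (hDmono (le_max_left S 0)).trans ?_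
    have h1 : 0 ≤ ∫ t in (0 : ℝ)..1, -(k (t * max S 0) * t) :=
      intervalIntegral.integral_nonneg zero_le_one fun t ht =>
        neg_nonneg.2 (mul_nonpos_of_nonpos_of_nonneg (hk0 _) ht.1)
    rw [intervalIntegral.integral_neg] at h1
    exact neg_nonneg.1 h1
  · rw [funext hmarg]; exact hφanti
  · simp [hF, hφ]
  · intro S hS
    rw [hSF]
    refine intervalIntegral.integral_congr fun u hu => ?_
    rw [uIcc_of_le hS.1] at hu
    exact (hkf u ⟨hu.1, hu.2.trans hS.2⟩).symm

/-! ### Variational inequalities on an interval. -/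

/-- For a convex differentiable function, minimality on an interval is a variational
inequality. -/
theorem isMinOn_Icc_iff_of_convexOn {c : ℝ → ℝ} {c' L U x₀ : ℝ} (hc : ConvexOn ℝ univ c)
    (hd : HasDerivAt c c' x₀) (hx₀ : x₀ ∈ Icc L U) :
    IsMinOn c (Icc L U) x₀ ↔ ∀ x ∈ Icc L U, 0 ≤ c' * (x - x₀) := by
  constructor
  · intro hmin x hx
    have h1 := hmin.localize.hasFDerivWithinAt_nonneg
      (hd.hasFDerivAt.hasFDerivWithinAt (s := Icc L U))
      (sub_mem_posTangentConeAt_of_segment_subset ((convex_Icc L U).segment_subset hx₀ hx))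
    simpa [mul_comm] using h1
  · intro hvar x hx
    have h1 := hvar x hx
    rcases lt_trichotomy x₀ x with h | h | h
    · have h2 := hc.le_slope_of_hasDerivAt (mem_univ _) (mem_univ _) h hd
      rw [slope_def_field, le_div_iff₀ (sub_pos.2 h)] at h2
      simp only [mem_ofPred_eq]; linarith
    · simp [h]
    · have h2 := hc.slope_le_of_hasDerivAt (mem_univ _) (mem_univ _) h hd
      rw [slope_def_field, div_le_iff₀ (sub_pos.2 h)] at h2
      simp only [mem_ofPred_eq]; linarith

/-- The projection onto an interval is characterized by a variational inequality. -/
theorem forall_sub_mul_sub_nonneg_iff {L U X x₀ : ℝ} (hx₀ : x₀ ∈ Icc L U) :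
    (∀ x ∈ Icc L U, 0 ≤ (x₀ - X) * (x - x₀)) ↔ x₀ = max L (min U X) := by
  obtain ⟨hL, hU⟩ := hx₀
  constructor
  · intro hvar
    have h1 := hvar L ⟨le_rfl, hL.trans hU⟩
    have h2 := hvar U ⟨hL.trans hU, le_rfl⟩
    rcases lt_trichotomy x₀ X with h | h | h
    · have : x₀ = U := by nlinarith
      rw [← this, min_eq_left h.le, max_eq_right hL]
    · rw [← h, min_eq_right hU, max_eq_right hL]
    · have : x₀ = L := by nlinarith
      rw [min_eq_right (h.le.trans hU), max_eq_left (by linarith), this]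
  · rintro h x ⟨hLx, hxU⟩
    rcases le_total X L with h1 | h1
    · rw [min_eq_right (h1.trans (hL.trans hU)), max_eq_left h1] at h
      subst h
      exact mul_nonneg (by linarith) (by linarith)
    · rcases le_total U X with h2 | h2
      · rw [min_eq_left h2, max_eq_right (hL.trans hU)] at h
        subst h
        exact mul_nonneg_of_nonpos_of_nonpos (by linarith) (by linarith)
      · rw [min_eq_right h2, max_eq_right h1] at h
        simp [h]

/-! ### Completeness of order-reversed compact sets. -/

/-- Every subset of a strictly antitone image of a nonempty compact set of reals has a least
upper bound and a greatest lower bound within the image. -/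
theorem exists_isLUB_isGLB_of_eq_image {α : Type*} [Preorder α] {K : Set ℝ} {C : Set α}
    {Φ : ℝ → α} (hK : IsCompact K) (hne : K.Nonempty)
    (hΦ : ∀ x ∈ K, ∀ y ∈ K, Φ x ≤ Φ y ↔ y ≤ x) (hC : C = Φ '' K) (T : Set C) :
    (∃ p, IsLUB T p) ∧ ∃ p, IsGLB T p := by
  subst hC
  have hmem : ∀ {x}, x ∈ K → Φ x ∈ Φ '' K := fun hx => mem_image_of_mem Φ hx
  set T' : Set ℝ := {x ∈ K | ∃ t ∈ T, t.1 = Φ x} with hT'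
  have hT'K : T' ⊆ K := fun x hx => hx.1
  obtain ⟨m, hmK, hmb, hmg⟩ : ∃ m ∈ K, m ∈ lowerBounds T' ∧ ∀ b ∈ K, b ∈ lowerBounds T' → b ≤ m := by
    rcases T'.eq_empty_or_nonempty with h | h
    -- The supremum of the empty set is the least element of the image, hence comes from the
    -- greatest point of `K`.
    · obtain ⟨m, hm⟩ := hK.exists_isGreatest hne
      exact ⟨m, hm.1, by simp [h], fun b hb _ => hm.2 hb⟩
    · have hbdd : BddBelow T' := hK.bddBelow.mono hT'K
      exact ⟨sInf T', hK.isClosed.closure_subset_iff.2 hT'K (csInf_mem_closure h hbdd),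
        fun x hx => csInf_le hbdd hx, fun b _ hb => le_csInf h hb⟩
  obtain ⟨m', hmK', hmb', hmg'⟩ :
      ∃ m ∈ K, m ∈ upperBounds T' ∧ ∀ b ∈ K, b ∈ upperBounds T' → m ≤ b := by
    rcases T'.eq_empty_or_nonempty with h | h
    · obtain ⟨m, hm⟩ := hK.exists_isLeast hne
      exact ⟨m, hm.1, by simp [h], fun b hb _ => hm.2 hb⟩
    · have hbdd : BddAbove T' := hK.bddAbove.mono hT'K
      exact ⟨sSup T', hK.isClosed.closure_subset_iff.2 hT'K (csSup_mem_closure h hbdd),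
        fun x hx => le_csSup hbdd hx, fun b _ hb => csSup_le h hb⟩
  refine ⟨⟨⟨Φ m, hmem hmK⟩, ?_, ?_⟩, ⟨⟨Φ m', hmem hmK'⟩, ?_, ?_⟩⟩
  · rintro ⟨_, x, hx, rfl⟩ ht
    exact (hΦ x hx m hmK).2 (hmb ⟨hx, _, ht, rfl⟩)
  · rintro ⟨_, b, hb, rfl⟩ hub
    refine (hΦ m hmK b hb).2 (hmg b hb ?_)
    rintro x ⟨hx, t, ht, htx⟩
    exact (hΦ x hx b hb).1 (htx ▸ hub ht)
  · rintro ⟨_, x, hx, rfl⟩ ht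
    exact (hΦ m' hmK' x hx).2 (hmb' ⟨hx, _, ht, rfl⟩)
  · rintro ⟨_, b, hb, rfl⟩ hlb
    refine (hΦ b hb m' hmK').2 (hmg' b hb ?_)
    rintro x ⟨hx, t, ht, htx⟩
    exact (hΦ b hb x hx).1 (htx ▸ hlb ht)

/-! ### Sale profiles and feasible sales. -/

theorem sum_mem_Icc_of_mem_Sales {a s : Fin n → ℝ} (hs : s ∈ Sales a) :
    ∑ j, s j ∈ Icc 0 (∑ j, a j) :=
  ⟨Finset.sum_nonneg fun j _ => (hs j).1, Finset.sum_le_sum fun j _ => (hs j).2⟩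

theorem update_mem_Sales {a s : Fin n → ℝ} (hs : s ∈ Sales a) {i : Fin n} {x : ℝ}
    (hx : x ∈ Icc 0 (a i)) : Function.update s i x ∈ Sales a := by
  intro j
  rcases eq_or_ne j i with rfl | hj
  · simpa using hx
  · simpa [hj] using hs j

/-- The volume weighted average price only depends on the total liquidation. -/
theorem vwap_eq_of_mem_Sales {a s : Fin n → ℝ} {f F : ℝ → ℝ} (hF0 : F 0 = 1)
    (hF : ∀ S ∈ Icc 0 (∑ j, a j), S * F S = ∫ σ in (0 : ℝ)..S, f σ) (hs : s ∈ Sales a)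
    (i : Fin n) : vwap f i s = F (∑ j, s j) := by
  by_cases h0 : s = 0
  · simp [vwap, h0, hF0]
  · have hS : ∑ j, s j ≠ 0 := fun h => h0 <| funext fun j =>
      (Finset.sum_eq_zero_iff_of_nonneg fun j _ => (hs j).1).1 h j (Finset.mem_univ j)
    rw [vwap, if_neg h0, ← hF _ (sum_mem_Icc_of_mem_Sales hs), mul_div_cancel_left₀ _ hS]

/-- The least liquidation with which bank `i` covers its shortfall, at haircut `q` and price
`p`. -/
noncomputable def minSale (a h : Fin n → ℝ) (q p : ℝ) (i : Fin n) : ℝ :=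
  min (a i) (max 0 ((h i - a i * q) / (p - q)))

/-- The largest liquidation with which bank `i` raises at most its shortfall, at price `p`. -/
noncomputable def maxSale (a h : Fin n → ℝ) (p : ℝ) (i : Fin n) : ℝ :=
  min (a i) (h i / p)

/-- The liquidation `x` that solves the unconstrained first order condition
`1 = (1 + r) (P + x P')` at average price `P` with slope `P'`. -/
noncomputable def targetSale (r P P' : ℝ) : ℝ :=
  ((1 + r) * P - 1) / ((1 + r) * -P')

/-- The unconstrained optimum, truncated to the feasible liquidations. -/
noncomputable def truncatedSale (a h : Fin n → ℝ) (q p x : ℝ) (i : Fin n) : ℝ :=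
  max (minSale a h q p i) (min (maxSale a h p i) x)

theorem truncatedSale_mem_Icc {a : Fin n → ℝ} (h : Fin n → ℝ) (q p x : ℝ) {i : Fin n}
    (ha : 0 ≤ a i) : truncatedSale a h q p x i ∈ Icc 0 (a i) :=
  ⟨(le_min ha (le_max_left _ _)).trans (le_max_left _ _),
    max_le (min_le_left _ _) ((min_le_left _ _).trans (min_le_left _ _))⟩

/-- In default the collateral bound is at least `a i`, so the cap in `minSale` takes over. One
formula, continuous across the default threshold, then covers both cases. -/
theorem truncatedSale_of_default {a h : Fin n → ℝ} {q p : ℝ} (x : ℝ) {i : Fin n}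
    (ha : 0 ≤ a i) (hqp : q < p) (hi : a i * p ≤ h i) :
    truncatedSale a h q p x i = a i := by
  have h1 : a i ≤ (h i - a i * q) / (p - q) := by
    rw [le_div_iff₀ (sub_pos.2 hqp)]; linarith
  have h2 : minSale a h q p i = a i := min_eq_left (h1.trans (le_max_right _ _))
  exact le_antisymm (truncatedSale_mem_Icc h q p x ha).2 (h2 ▸ le_max_left _ _)

theorem feasible_eq_Icc {a h : Fin n → ℝ} {q : ℝ} {qbar : Fin n → ℝ} {i : Fin n}
    (ha : 0 ≤ a i) (hqp : q < qbar i) (hi : h i < a i * qbar i) :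
    feasible a h q qbar i = Icc (minSale a h q (qbar i) i) (maxSale a h (qbar i) i) := by
  have h1 : (h i - a i * q) / (qbar i - q) ≤ a i := by
    rw [div_le_iff₀ (sub_pos.2 hqp)]; linarith
  ext x
  simp only [feasible, minSale, maxSale, min_eq_right (max_le ha h1), mem_ofPred_eq, mem_Icc,
    max_le_iff, le_min_iff]
  tauto

theorem minSale_le_maxSale {a h : Fin n → ℝ} {q p : ℝ} {i : Fin n} (hh : 0 ≤ h i)
    (hq : 0 ≤ q) (hqp : q < p) (hi : h i ≤ a i * p) : minSale a h q p i ≤ maxSale a h p i := by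
  have hp : 0 < p := hq.trans_lt hqp
  refine le_min (min_le_left _ _) ((min_le_right _ _).trans (max_le (div_nonneg hh hp.le) ?_))
  rw [div_le_div_iff₀ (sub_pos.2 hqp) hp]
  -- After cross-multiplication this is `0 ≤ q * (a i * p - h i)`.
  nlinarith

/-! ### Best responses. -/

/-- Marginal characterization of the liquidations that are optimal on an interval, against total
liquidations `y` of the other banks. -/
theorem isMinOn_cost_iff {F D : ℝ → ℝ} (hFD : ∀ S, HasDerivAt F (D S) S) (hDm : Monotone D)
    (hmarg : Antitone fun S => F S + S * D S) {r : ℝ} (hr : 0 ≤ r) (b : ℝ) {y L U x₀ : ℝ}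
    (hy : 0 ≤ y) (hx₀ : x₀ ∈ Icc L U) (hneg : D (x₀ + y) < 0) :
    IsMinOn (fun x => x * (1 - F (x + y)) + r * (b - x * F (x + y))) (Icc L U) x₀ ↔
      x₀ = max L (min U (targetSale r (F (x₀ + y)) (D (x₀ + y)))) := by
  set c : ℝ → ℝ := fun x => x * (1 - F (x + y)) + r * (b - x * F (x + y)) with hc
  have hd : ∀ x, HasDerivAt c (1 - (1 + r) * (F (x + y) + x * D (x + y))) x := by
    intro x
    have h1 : HasDerivAt (fun x => F (x + y)) (D (x + y)) x :=
      (hFD (x + y)).comp_add_const x y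
    have h2 : HasDerivAt (fun x => x * F (x + y)) (1 * F (x + y) + x * D (x + y)) x :=
      (hasDerivAt_id x).mul h1
    have h3 := ((hasDerivAt_id x).mul (h1.const_sub 1)).add ((h2.const_sub b).const_mul r)
    exact h3.congr_deriv (by simp only [id]; ring)
  -- With `S = x + y`, `F + x D = (F + S D) - y D`; both terms are nonincreasing in `x`, so marginal
  -- cost is nondecreasing.
  have hconv : ConvexOn ℝ univ c := by
    refine Monotone.convexOn_univ_of_deriv (fun x => (hd x).differentiableAt) fun u v huv => ?_
    rw [(hd u).deriv, (hd v).deriv]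
    have h1 : F (v + y) + (v + y) * D (v + y) ≤ F (u + y) + (u + y) * D (u + y) :=
      hmarg (by linarith)
    have h2 := mul_le_mul_of_nonneg_left (hDm (by linarith : u + y ≤ v + y)) hy
    have h3 : F (v + y) + v * D (v + y) ≤ F (u + y) + u * D (u + y) := by linarith
    have h4 := mul_le_mul_of_nonneg_left h3 (by linarith : 0 ≤ 1 + r)
    linarith
  rw [isMinOn_Icc_iff_of_convexOn hconv (hd x₀) hx₀, ← forall_sub_mul_sub_nonneg_iff hx₀]
  have hpos : 0 < (1 + r) * -D (x₀ + y) := mul_pos (by linarith) (by linarith)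
  -- With the total frozen at `x₀ + y`, marginal cost is a positive multiple of `x₀` minus the
  -- target, which turns optimality into a projection.
  have hfac : 1 - (1 + r) * (F (x₀ + y) + x₀ * D (x₀ + y)) =
      (1 + r) * -D (x₀ + y) * (x₀ - targetSale r (F (x₀ + y)) (D (x₀ + y))) := by
    rw [targetSale, mul_sub, mul_div_cancel₀ _ hpos.ne']
    ring
  refine forall₂_congr fun x _ => ?_
  rw [hfac, mul_assoc, mul_nonneg_iff_of_pos_left hpos]

/-- If prices only depend on the total liquidation, then a best response is the solution of the
first order condition at that total, truncated to the feasible liquidations. -/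
theorem isBestResponse_iff {a h : Fin n → ℝ} {r : ℝ} {fbar : Fin n → (Fin n → ℝ) → ℝ}
    {F D : ℝ → ℝ} (hfbar : ∀ s ∈ Sales a, ∀ i, fbar i s = F (∑ j, s j))
    (hFD : ∀ S, HasDerivAt F (D S) S) (hDm : Monotone D)
    (hmarg : Antitone fun S => F S + S * D S) (hr : 0 ≤ r) {q : ℝ} {qbar : Fin n → ℝ}
    {s : Fin n → ℝ} (hs : s ∈ Sales a) {i : Fin n} (ha : 0 ≤ a i) (hh : 0 ≤ h i) (hq : 0 ≤ q)
    (hqp : q < qbar i) (hneg : D (∑ j, s j) < 0) :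
    IsBestResponse a h r fbar q qbar s i ↔
      s i = truncatedSale a h q (qbar i)
        (targetSale r (F (∑ j, s j)) (D (∑ j, s j))) i := by
  rcases le_or_gt (a i * qbar i) (h i) with hi | hi
  · rw [truncatedSale_of_default _ ha hqp hi]
    exact ⟨fun H => H.1 hi, fun H => ⟨fun _ => H, fun H' => absurd H' hi.not_gt⟩⟩
  set y := ∑ j ∈ Finset.univ \ {i}, s j with hy
  have hy0 : 0 ≤ y := Finset.sum_nonneg fun j _ => (hs j).1
  have hupd : ∀ x, ∑ j, Function.update s i x j = x + y := fun x =>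
    Finset.sum_update_of_mem (Finset.mem_univ i) s x
  have hsum : ∑ j, s j = s i + y := by
    rw [← hupd (s i), Function.update_eq_self]
  have hfeas := feasible_eq_Icc ha hqp hi
  have hcost : ∀ x ∈ feasible a h q qbar i, cost h r fbar i (Function.update s i x) =
      x * (1 - F (x + y)) + r * (h i - x * F (x + y)) := by
    intro x hx
    rw [cost, hfbar _ (update_mem_Sales hs hx.1) i, hupd, Function.update_self]
  have key : s i ∈ feasible a h q qbar i →
      (IsMinOn (fun x => cost h r fbar i (Function.update s i x)) (feasible a h q qbar i) (s i) ↔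
        s i = truncatedSale a h q (qbar i)
          (targetSale r (F (∑ j, s j)) (D (∑ j, s j))) i) := by
    intro hmem
    have h1 := isMinOn_cost_iff hFD hDm hmarg hr (h i) hy0 (hfeas ▸ hmem) (hsum ▸ hneg)
    rw [hsum, truncatedSale, ← h1, ← hfeas, isMinOn_iff, isMinOn_iff]
    refine forall₂_congr fun x hx => ?_
    rw [hcost x hx, hcost _ hmem]
  constructor
  · exact fun H => (key (H.2 hi).1).1 (H.2 hi).2
  · intro H
    have hmem : s i ∈ feasible a h q qbar i := by
      rw [hfeas, H]
      exact ⟨le_max_left _ _,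
        max_le (minSale_le_maxSale hh hq hqp hi.le) (min_le_left _ _)⟩
    exact ⟨fun hi' => absurd hi' hi.not_ge, fun _ => ⟨hmem, (key hmem).2 H⟩⟩

/-! ### Reduction to a scalar equation. -/

/-- The clearing vectors are parametrized, in a strictly antitone way, by a nonempty compact set
of total liquidations. -/
theorem exists_compact_parametrization {a h : Fin n → ℝ} (ha : ∀ i, 0 < a i)
    (hh : ∀ i, 0 < h i) {r : ℝ} (hr : 0 ≤ r) {M : ℝ} (hM : ∑ i, a i ≤ M) {f g : ℝ → ℝ}
    (hf : OrderBookAssumption M f) (hg : HaircutAssumption a M (vwap f) g) :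
    ∃ (K : Set ℝ) (Φ : ℝ → ℝ × (Fin n → ℝ)), IsCompact K ∧ K.Nonempty ∧
      (∀ x ∈ K, ∀ y ∈ K, Φ x ≤ Φ y ↔ y ≤ x) ∧ clearing a h r (vwap f) g = Φ '' K := by
  -- Without banks `M` may be `0`, and `lt_price` says nothing.
  rcases isEmpty_or_nonempty (Fin n) with hn | hn
  · refine ⟨{0}, fun _ => (g 0, 0), isCompact_singleton, singleton_nonempty 0, by simp, ?_⟩
    ext p
    simp only [clearing, image_singleton, mem_singleton_iff, mem_ofPred_eq]
    constructor
    · rintro ⟨s, -, h1, -⟩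
      exact Prod.ext (by simpa using h1) (Subsingleton.elim _ _)
    · rintro rfl
      exact ⟨0, ⟨fun i => isEmptyElim i, fun i => isEmptyElim i⟩, by simp, fun i => isEmptyElim i⟩
  set A := ∑ i, a i with hA
  have hA0 : 0 < A := Finset.sum_pos (fun i _ => ha i) Finset.univ_nonempty
  have hAM : Icc 0 A ⊆ Icc 0 M := Icc_subset_Icc_right hM
  obtain ⟨F, D, hFD, hDc, hDm, hD0, hDneg, hmarg, hF0, hFint⟩ :=
    exists_average_extension (hA0.trans_le hM) hf
  have hFc : Continuous F := continuous_iff_continuousAt.2 fun S => (hFD S).continuousAt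
  have hFanti : Antitone F := antitone_of_deriv_nonpos (fun S => (hFD S).differentiableAt)
    fun S => by rw [(hFD S).deriv]; exact hD0 S
  have hvwap : ∀ s ∈ Sales a, ∀ i, vwap f i s = F (∑ j, s j) := fun s hs i =>
    vwap_eq_of_mem_Sales hF0 (fun S hS => hFint S (hAM hS)) hs i
  have hgpos : ∀ S ∈ Icc 0 A, 0 < g S := fun S hS => (hg.mapsTo (hAM hS)).1
  have hgF : ∀ S ∈ Icc 0 A, g S < F S := by
    intro S hS
    -- A proportional profile realizes the total `S`, turning `lt_price` into a bound on totals.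
    have hs : (fun i => S / A * a i) ∈ Sales a := fun i =>
      ⟨mul_nonneg (div_nonneg hS.1 hA0.le) (ha i).le,
        mul_le_of_le_one_left (ha i).le ((div_le_one hA0).2 hS.2)⟩
    have hsum : ∑ i, S / A * a i = S := by
      rw [← Finset.mul_sum, ← hA, div_mul_cancel₀ _ hA0.ne']
    have h1 := hg.lt_price _ hs (Classical.arbitrary _)
    rwa [hvwap _ hs, hsum] at h1
  set B : Fin n → ℝ → ℝ := fun i S =>
    truncatedSale a h (g S) (F S) (targetSale r (F S) (D S)) i with hB
  have hBmem : ∀ S, (fun i => B i S) ∈ Sales a := fun S i =>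
    truncatedSale_mem_Icc h _ _ _ (ha i).le
  have hBc : ∀ i, ContinuousOn (B i) (Icc 0 A) := by
    intro i
    have hgc : ContinuousOn g (Icc 0 A) := hg.continuousOn.mono hAM
    have h1 : ContinuousOn (fun S => (h i - a i * g S) / (F S - g S)) (Icc 0 A) :=
      (by fun_prop : ContinuousOn (fun S => h i - a i * g S) (Icc 0 A)).div
        (hFc.continuousOn.sub hgc) fun S hS => (sub_pos.2 (hgF S hS)).ne'
    have h2 : ContinuousOn (fun S => h i / F S) (Icc 0 A) :=
      continuousOn_const.div hFc.continuousOn fun S hS => ((hgpos S hS).trans (hgF S hS)).ne'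
    have h3 : ContinuousOn (fun S => ((1 + r) * F S - 1) / ((1 + r) * -D S)) (Icc 0 A) :=
      (by fun_prop : ContinuousOn (fun S => (1 + r) * F S - 1) (Icc 0 A)).div (by fun_prop)
        fun S hS => (mul_pos (by linarith : 0 < 1 + r) (neg_pos.2 (hDneg S (hAM hS)))).ne'
    simp only [hB, truncatedSale, minSale, maxSale, targetSale]
    fun_prop
  have hexc : ContinuousOn (fun S => ∑ i, B i S - S) (Icc 0 A) :=
    (continuousOn_finsetSum _ fun i _ => hBc i).sub continuousOn_id
  refine ⟨Icc 0 A ∩ (fun S => ∑ i, B i S - S) ⁻¹' {0}, fun S => (g S, fun _ => F S), ?_, ?_, ?_,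
    ?_⟩
  · exact isCompact_Icc.of_isClosed_subset
      (hexc.preimage_isClosed_of_isClosed isClosed_Icc isClosed_singleton) inter_subset_left
  -- The excess is nonnegative at `0` and nonpositive at `A`, as each `B i` lies in `[0, a i]`.
  · have h0 := (sum_mem_Icc_of_mem_Sales (hBmem 0)).1
    have h1 := (sum_mem_Icc_of_mem_Sales (hBmem A)).2
    obtain ⟨S, hS, hS0⟩ := intermediate_value_Icc' hA0.le hexc
      (show (0 : ℝ) ∈ Icc (∑ i, B i A - A) (∑ i, B i 0 - 0) from
        ⟨by linarith, by linarith⟩)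
    exact ⟨S, hS, hS0⟩
  · rintro x ⟨hx, -⟩ y ⟨hy, -⟩
    refine ⟨fun hle => (hg.strictAntiOn.le_iff_ge (hAM hx) (hAM hy)).1 hle.1, fun hle => ?_⟩
    exact ⟨(hg.strictAntiOn.le_iff_ge (hAM hx) (hAM hy)).2 hle, fun _ => hFanti hle⟩
  · have hbest : ∀ s ∈ Sales a, ∀ i,
        IsBestResponse a h r (vwap f) (g (∑ j, s j)) (fun _ => F (∑ j, s j)) s i ↔
          s i = B i (∑ j, s j) := fun s hs i =>
      have hS := sum_mem_Icc_of_mem_Sales hs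
      isBestResponse_iff hvwap hFD hDm hmarg hr hs (ha i).le (hh i).le (hgpos _ hS).le
        (hgF _ hS) (hDneg _ (hAM hS))
    ext p
    constructor
    · rintro ⟨s, ⟨hs, hbr⟩, h1, h2⟩
      have hp : p = (g (∑ j, s j), fun _ => F (∑ j, s j)) :=
        Prod.ext h1 (funext fun i => (h2 i).trans (hvwap s hs i))
      subst hp
      refine ⟨∑ j, s j, ⟨sum_mem_Icc_of_mem_Sales hs, ?_⟩, rfl⟩
      rw [mem_preimage, mem_singleton_iff, sub_eq_zero]
      exact Finset.sum_congr rfl fun i _ => ((hbest s hs i).1 (hbr i)).symm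
    · rintro ⟨S, ⟨hS, hS0⟩, rfl⟩
      have hsum : ∑ i, B i S = S := sub_eq_zero.1 hS0
      -- This profile has total `S`, so it is tested against best responses at its own total.
      refine ⟨fun i => B i S, ⟨hBmem S, fun i => ?_⟩, ?_, fun i => ?_⟩
      · have h1 := (hbest _ (hBmem S) i).2
        simp only [hsum] at h1
        exact h1 trivial
      · simp only [hsum]
      · rw [hvwap _ (hBmem S) i, hsum]

end RepoFireSale

open RepoFireSale in
/-- The clearing haircuts and prices, with the componentwise order, form a (complete) lattice:
every subset has a supremum and an infimum within the set. In particular there are a greatest and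
a least clearing vector. -/
theorem theorem1 (n : ℕ) (a h : Fin n → ℝ) (ha : ∀ i, 0 < a i) (hh : ∀ i, 0 < h i)
    (r : ℝ) (hr : 0 ≤ r) (M : ℝ) (hM : ∑ i, a i ≤ M) (f g : ℝ → ℝ)
    (hf : OrderBookAssumption M f)
    (hg : HaircutAssumption a M (vwap f) g)
    (hfund : FundingAssumption a (vwap f) g) :
    (∀ T : Set (clearing a h r (vwap f) g),
      (∃ p, IsLUB T p) ∧ (∃ p, IsGLB T p)) ∧
    ∃ pUp pDown : ℝ × (Fin n → ℝ),
      IsGreatest (clearing a h r (vwap f) g) pUp ∧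
      IsLeast (clearing a h r (vwap f) g) pDown ∧ pDown ≤ pUp := by
  obtain ⟨K, Φ, hK, hne, hΦ, hC⟩ := exists_compact_parametrization ha hh hr hM hf hg
  have hlat := exists_isLUB_isGLB_of_eq_image hK hne hΦ hC
  refine ⟨hlat, ?_⟩
  obtain ⟨⟨⟨pUp, hUp⟩, hlub⟩, ⟨⟨pDown, hDown⟩, hglb⟩⟩ := hlat univ
  exact ⟨pUp, pDown, ⟨hUp, fun p hp => hlub.1 (mem_univ (⟨p, hp⟩ : clearing a h r (vwap f) g))⟩,
    ⟨hDown, fun p hp => hglb.1 (mem_univ (⟨p, hp⟩ : clearing a h r (vwap f) g))⟩,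
    hlub.1 (mem_univ (⟨pDown, hDown⟩ : clearing a h r (vwap f) g))⟩
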